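/- Let $n \ge 1$ be an integer and let $(V,\|\cdot\|)$ be a two-dimensional real normed space with unit ball $B=\{x\in V:\|x\|\le 1\}$ and unit circle $S=\{x\in V:\|x\|=1\}$. For $x\in S$ let $\mathrm{bis}(-x,x)=\{z\in V:\|z+x\|=\|z-x\|\}$, and let $$P_I(x)=\left\{\frac{z}{\|z\|} : z\in \left(\mathrm{bis}(-x,x)\cap B\right)\setminus\{0\}\right\}.$$ For $w,x\in S$ put $s(w,x)=\inf_{t\in\mathbb{R}}\|w+tx\|$, and define $$c_B(\|\cdot\|)=\inf_{x\in S}\ \inf_{w\in P_I(x)} s(w,x).$$ Suppose that $S$ is an affine regular $4n$-gon, that is, the image of (the boundary of) a regular $4n$-gon in the Euclidean plane under an invertible affine map. Then $$c_B(\|\cdot\|)=\left(\cos\frac{\pi}{4n}\right)^2.$$ -/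

import Mathlib

noncomputable section

namespace NormedPlane

section

variable {V : Type*} [NormedAddCommGroup V] [NormedSpace ℝ V]

/-- The bisector of `x` and `y`: the set of points equidistant to `x` and `y`. -/
def bis (x y : V) : Set V := {z | ‖z - x‖ = ‖z - y‖}

/-- The inner bisector of the segment from `-x` to `x`: the part of the bisector of `-x` and `x`
that lies in the closed unit ball. -/
def innerBis (x : V) : Set V := bis (-x) x ∩ Metric.closedBall 0 1

/-- The inner projection: the radial projection to the unit circle of the inner bisector
without the origin. -/
def innerProj (x : V) : Set V := (fun z : V => ‖z‖⁻¹ • z) '' (innerBis x \ {0})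

/-- The generalized sine function `s(x, y) = inf {‖x + t y‖ : t ∈ ℝ}`. -/
def sine (x y : V) : ℝ := ⨅ t : ℝ, ‖x + t • y‖

end

/-- The constant `c_B = inf_{x ∈ S} inf_{w ∈ P_I(x)} s(w, x)` of a normed plane, where `S` is the
unit circle. The values of `sine` are non-negative. In a plane both index sets are non-empty:
the continuous function `y ↦ ‖y - x‖ - ‖y + x‖` changes sign on the connected set `S`, so it
vanishes at some `y ∈ S`, and this `y` lies in `P_I(x)`. So both infima are genuine. -/
def cB (V : Type*) [NormedAddCommGroup V] [NormedSpace ℝ V] : ℝ :=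
  ⨅ x : Metric.sphere (0 : V) 1, ⨅ w : innerProj (x : V), sine (w : V) (x : V)

/-- A polygon `P` with `m` vertices in a real vector space is affine regular if it is the image of
the standard regular `m`-gon in the Euclidean plane `ℂ`, whose consecutive vertices are
`exp (2 π i k / m)`, under an invertible affine map. -/
def IsAffineRegular {V : Type*} [AddCommGroup V] [Module ℝ V] {m : ℕ} (P : Polygon V m) : Prop :=
  ∃ T : ℂ ≃ᵃ[ℝ] V, ∀ k : Fin m,
    P k = T (Complex.exp (2 * Real.pi * Complex.I * ((k : ℕ) : ℂ) / (m : ℂ)))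

end NormedPlane

end

/-! Put α = π/(4n), and read `V` as ℂ normed by the gauge of the regular 4n-gon inscribed in the
Euclidean unit circle. The gauge lies between |z| and |z|/cos α. Lower bound: if z is in the
bisector of -x and x, then z + x = rp and z - x = rq with p, q on the polygon. Polarization turns an
inequality between |p|² - |q|² and Im(p̄q) (`abs_normSq_sub_le`) into the statement that z is within
angle α of being Euclidean-orthogonal to x (`cos_mul_norm_mul_norm_le`). This costs one factor cos
α; comparing the gauge of z with |z| costs the other (`cos_sq_le_sine`). Upper bound: take x inside
an edge and let w be the unit vector parallel to that edge. Short multiples of w are in the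
bisector, and s(w, x) tends to cos² α as x tends to a vertex (`exists_sine_le`). -/

namespace NormedPlane

open Complex ComplexConjugate

/-! ### Coordinates on the edges of the regular 4n-gon -/

/-- The point with parameter `s ∈ [-1, 1]` on the edge from `exp (2kαi)` to `exp (2(k+1)αi)`. -/
noncomputable def edgePoint (α : ℝ) (k : ℕ) (s : ℝ) : ℂ :=
  exp (((2 * k + 1) * α : ℝ) * I) * ⟨Real.cos α, s * Real.sin α⟩

lemma normSq_edgePoint (α : ℝ) (k : ℕ) (s : ℝ) :
    normSq (edgePoint α k s) = Real.cos α ^ 2 + Real.sin α ^ 2 * s ^ 2 := by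
  rw [edgePoint, map_mul, normSq_eq_norm_sq, norm_exp_ofReal_mul_I, normSq_mk]
  ring

lemma norm_edgePoint_le (α : ℝ) (k : ℕ) {s : ℝ} (hs : |s| ≤ 1) : ‖edgePoint α k s‖ ≤ 1 := by
  rw [← sq_le_one_iff₀ (norm_nonneg _), ← normSq_eq_norm_sq, normSq_edgePoint]
  have := (sq_le_one_iff_abs_le_one s).2 hs
  nlinarith [Real.sin_sq_add_cos_sq α, mul_le_mul_of_nonneg_left this (sq_nonneg (Real.sin α))]

lemma conj_mul_edgePoint_im (α : ℝ) (k l : ℕ) (s t : ℝ) :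
    (conj (edgePoint α k s) * edgePoint α l t).im =
      Real.cos (2 * ((l : ℤ) - k : ℤ) * α) * (Real.cos α * Real.sin α * (t - s)) +
        Real.sin (2 * ((l : ℤ) - k : ℤ) * α) * (Real.cos α ^ 2 + Real.sin α ^ 2 * (s * t)) := by
  have h : (2 * ((l : ℤ) - k : ℤ) * α : ℝ) = (2 * l + 1) * α - (2 * k + 1) * α := by
    push_cast; ring
  rw [h, Real.cos_sub, Real.sin_sub, edgePoint, edgePoint, exp_mul_I, exp_mul_I,
    ← ofReal_cos, ← ofReal_sin, ← ofReal_cos, ← ofReal_sin]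
  simp only [map_mul, map_add, conj_ofReal, conj_I, mul_im, mul_re, add_re, add_im, ofReal_re,
    ofReal_im, conj_re, conj_im, I_re, I_im, neg_re, neg_im]
  ring

lemma edgePoint_quarter_turn {n : ℕ} (hn : 1 ≤ n) (s : ℝ) :
    edgePoint (Real.pi / (4 * n)) n s = I * edgePoint (Real.pi / (4 * n)) 0 s := by
  have hn0 : (n : ℝ) ≠ 0 := by positivity
  have e : ((2 * n + 1) * (Real.pi / (4 * n)) : ℝ) =
      Real.pi / 2 + (2 * (0 : ℕ) + 1) * (Real.pi / (4 * n)) := by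
    push_cast; field_simp; ring
  rw [edgePoint, edgePoint, e, ofReal_add, add_mul, exp_add, ofReal_div, ofReal_ofNat,
    exp_pi_div_two_mul_I, mul_assoc]

lemma edgePoint_zero_re (α s : ℝ) :
    (edgePoint α 0 s).re = Real.cos α ^ 2 - s * Real.sin α ^ 2 := by
  rw [edgePoint, exp_mul_I, ← ofReal_cos, ← ofReal_sin]
  simp [-ofReal_cos, -ofReal_sin]
  ring

lemma edgePoint_zero_neg_one (α : ℝ) : edgePoint α 0 (-1) = 1 := by
  rw [edgePoint, exp_mul_I, ← ofReal_cos, ← ofReal_sin]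
  apply Complex.ext
  · simp [-ofReal_cos, -ofReal_sin]
    nlinarith [Real.sin_sq_add_cos_sq α]
  · simp [-ofReal_cos, -ofReal_sin]
    ring

lemma edgePoint_half_turn {n : ℕ} (hn : 1 ≤ n) (s : ℝ) :
    edgePoint (Real.pi / (4 * n)) (2 * n) s = -edgePoint (Real.pi / (4 * n)) 0 s := by
  have hn0 : (n : ℝ) ≠ 0 := by positivity
  have e : ((2 * (2 * n : ℕ) + 1) * (Real.pi / (4 * n)) : ℝ) =
      Real.pi + (2 * (0 : ℕ) + 1) * (Real.pi / (4 * n)) := by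
    push_cast; field_simp; ring
  rw [edgePoint, edgePoint, e, ofReal_add, add_mul, exp_add, exp_pi_mul_I]
  ring

/-! ### The inequality for two boundary points -/

lemma edge_inequality_aux {σ2 S T : ℝ} (h0 : 0 ≤ σ2) (h1 : σ2 ≤ 1 / 2) (hS : |S| ≤ 1)
    (hT : |T| ≤ 1) :
    |S - T| * |S + T| ≤ 4 * ((1 - σ2) + σ2 * (S * T)) - 2 * (1 - 2 * σ2) * |S - T| := by
  have hsum : |S - T| + |S + T| ≤ 2 := by
    rw [abs_le] at hS hT
    rcases abs_cases (S - T) with h | h <;> rcases abs_cases (S + T) with h' | h' <;> linarith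
  have hprod : S * T = (|S + T| ^ 2 - |S - T| ^ 2) / 4 := by
    rw [sq_abs, sq_abs]; ring
  rw [hprod]
  have hD := abs_nonneg (S - T)
  have hA := abs_nonneg (S + T)
  generalize |S - T| = D at *
  generalize |S + T| = A at *
  -- Both bounds follow from D + A ≤ 2. The claim is their combination with weights 1 - 2σ2 and 2σ2,
  -- which are non-negative because σ2 ≤ 1/2.
  have e0 : D * A ≤ 4 - 2 * D := by nlinarith
  have e1 : D * A ≤ 2 + (A ^ 2 - D ^ 2) / 2 := by nlinarith
  nlinarith [mul_le_mul_of_nonneg_left e0 (by linarith : 0 ≤ 1 - 2 * σ2),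
    mul_le_mul_of_nonneg_left e1 (by linarith : 0 ≤ 2 * σ2)]

/-- Here c, σ are the cosine and sine of α, and C, D those of the angle between the normals of two
edges. For parallel edges (D = 0) only |S + T| ≤ 2 is needed. Otherwise |D| ≥ sin 2α = 2cσ, and the
D-term dominates the C-term by the reverse triangle inequality. -/
lemma edge_inequality {c σ C D S T : ℝ} (hc : 0 ≤ c) (hσ : 0 ≤ σ) (h1 : c ^ 2 + σ ^ 2 = 1)
    (hσc : σ ^ 2 ≤ 1 / 2) (hCD : C ^ 2 + D ^ 2 = 1) (hD : D = 0 ∨ |C| ≤ c ^ 2 - σ ^ 2)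
    (hS : |S| ≤ 1) (hT : |T| ≤ 1) :
    |(c ^ 2 + σ ^ 2 * S ^ 2) - (c ^ 2 + σ ^ 2 * T ^ 2)| * c ≤
      2 * σ * |C * (c * σ * (T - S)) + D * (c ^ 2 + σ ^ 2 * (S * T))| := by
  have hL : |(c ^ 2 + σ ^ 2 * S ^ 2) - (c ^ 2 + σ ^ 2 * T ^ 2)| = σ ^ 2 * (|S - T| * |S + T|) := by
    rw [← abs_mul, ← abs_of_nonneg (sq_nonneg σ), ← abs_mul, abs_of_nonneg (sq_nonneg σ)]
    congr 1; ring
  rw [hL]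
  have hcσ : 0 ≤ c * σ := mul_nonneg hc hσ
  have hST : |S * T| ≤ 1 := by
    rw [abs_mul]; exact mul_le_one₀ hS (abs_nonneg _) hT
  rcases hD with rfl | hD
  · have hC : |C| = 1 := by
      rw [← pow_eq_one_iff_of_nonneg (abs_nonneg C) two_ne_zero, sq_abs]; linarith
    rw [zero_mul, add_zero, abs_mul, hC, abs_mul, abs_of_nonneg hcσ, abs_sub_comm T S]
    have : |S + T| ≤ 2 := (abs_add_le S T).trans (by linarith)
    nlinarith [mul_le_mul_of_nonneg_left this
      (mul_nonneg (mul_nonneg hcσ hσ) (abs_nonneg (S - T)))]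
  · have hD' : 2 * (c * σ) ≤ |D| := by
      refine abs_le_of_sq_le_sq' ?_ (abs_nonneg D) |>.2
      have := sq_le_sq' (by linarith [abs_nonneg C]) hD
      rw [sq_abs] at this ⊢
      nlinarith
    have hP : 0 ≤ c ^ 2 + σ ^ 2 * (S * T) := by
      nlinarith [(abs_le.1 hST).1]
    have hlow : 2 * (c * σ) * (c ^ 2 + σ ^ 2 * (S * T)) - (c ^ 2 - σ ^ 2) * (c * σ * |S - T|) ≤
        |C * (c * σ * (T - S)) + D * (c ^ 2 + σ ^ 2 * (S * T))| := by
      have t1 : |D * (c ^ 2 + σ ^ 2 * (S * T))| - |C * (c * σ * (T - S))| ≤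
          |C * (c * σ * (T - S)) + D * (c ^ 2 + σ ^ 2 * (S * T))| := by
        have := abs_sub_abs_le_abs_sub (D * (c ^ 2 + σ ^ 2 * (S * T))) (-(C * (c * σ * (T - S))))
        rwa [abs_neg, sub_neg_eq_add, add_comm (D * _)] at this
      rw [abs_mul, abs_of_nonneg hP, abs_mul, abs_mul (c * σ), abs_of_nonneg hcσ,
        abs_sub_comm T S] at t1
      have t2 := mul_le_mul_of_nonneg_right hD' hP
      have t3 := mul_le_mul_of_nonneg_right hD (mul_nonneg hcσ (abs_nonneg (S - T)))
      linarith
    have haux := edge_inequality_aux (sq_nonneg σ) hσc hS hT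
    have hc2 : c ^ 2 = 1 - σ ^ 2 := by linarith
    rw [hc2] at hlow
    have k1 := mul_le_mul_of_nonneg_left haux (mul_nonneg hcσ hσ)
    have k2 := mul_le_mul_of_nonneg_left hlow (by linarith : 0 ≤ 2 * σ)
    rw [hc2]
    nlinarith

/-- Modulo π, a multiple of π/m is either 0 or at distance at least π/m from both 0 and π. -/
lemma sin_eq_zero_or_abs_cos_le {m : ℕ} (hm : 1 ≤ m) (j : ℤ) :
    Real.sin (j * (Real.pi / m)) = 0 ∨
      |Real.cos (j * (Real.pi / m))| ≤ Real.cos (Real.pi / m) := by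
  have hm0 : (0 : ℝ) < m := by exact_mod_cast hm
  have hπ := Real.pi_pos
  obtain ⟨q, r, hr0, hrm, rfl⟩ : ∃ q r : ℤ, 0 ≤ r ∧ r < m ∧ j = r + q * m :=
    ⟨j / m, j % m, Int.emod_nonneg _ (by omega), Int.emod_lt_of_pos _ (by omega),
      by rw [mul_comm]; exact (Int.emod_add_mul_ediv j m).symm⟩
  have e : ((r + q * m : ℤ) : ℝ) * (Real.pi / m) = r * (Real.pi / m) + q * Real.pi := by
    push_cast; field_simp
  rw [e, Real.sin_add_int_mul_pi, Real.cos_add_int_mul_pi]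
  rcases hr0.eq_or_lt with rfl | hr
  · left; simp
  · right
    rw [abs_mul, abs_zpow, abs_neg, abs_one, one_zpow, one_mul, abs_le]
    have hδ : 0 < Real.pi / m := by positivity
    have hmδ : m * (Real.pi / m) = Real.pi := by field_simp
    have r1 : (1 : ℝ) ≤ r := by exact_mod_cast hr
    have r2 : (r : ℝ) + 1 ≤ m := by exact_mod_cast hrm
    have b1 : Real.pi / m ≤ r * (Real.pi / m) := by nlinarith
    have b2 : r * (Real.pi / m) ≤ Real.pi - Real.pi / m := by nlinarith
    constructor
    · rw [← Real.cos_pi_sub]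
      exact Real.cos_le_cos_of_nonneg_of_le_pi (by linarith) (by linarith) b2
    · exact Real.cos_le_cos_of_nonneg_of_le_pi hδ.le (by linarith) b1

lemma angle_pos {n : ℕ} (hn : 1 ≤ n) : 0 < Real.pi / (4 * n) := by
  have : (0 : ℝ) < n := by exact_mod_cast hn
  have := Real.pi_pos
  positivity

lemma angle_le {n : ℕ} (hn : 1 ≤ n) : Real.pi / (4 * n) ≤ Real.pi / 4 := by
  have : (1 : ℝ) ≤ n := by exact_mod_cast hn
  have := Real.pi_pos
  gcongr
  linarith

lemma cos_angle_pos {n : ℕ} (hn : 1 ≤ n) : 0 < Real.cos (Real.pi / (4 * n)) :=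
  Real.cos_pos_of_mem_Ioo
    ⟨by linarith [angle_pos hn, Real.pi_pos], by linarith [angle_le hn, Real.pi_pos]⟩

lemma sin_angle_pos {n : ℕ} (hn : 1 ≤ n) : 0 < Real.sin (Real.pi / (4 * n)) :=
  Real.sin_pos_of_pos_of_lt_pi (angle_pos hn) (by linarith [angle_le hn, Real.pi_pos])

lemma sin_angle_sq_le {n : ℕ} (hn : 1 ≤ n) : Real.sin (Real.pi / (4 * n)) ^ 2 ≤ 1 / 2 := by
  have h := Real.sin_le_sin_of_le_of_le_pi_div_two (x := Real.pi / (4 * n)) (y := Real.pi / 4)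
    (by linarith [angle_pos hn, Real.pi_pos]) (by linarith [Real.pi_pos]) (angle_le hn)
  have h2 := pow_le_pow_left₀ (sin_angle_pos hn).le h 2
  rw [Real.sin_pi_div_four, div_pow, Real.sq_sqrt (by norm_num)] at h2
  linarith

lemma abs_normSq_sub_le {n : ℕ} (hn : 1 ≤ n) (k l : ℕ) {s t : ℝ} (hs : |s| ≤ 1) (ht : |t| ≤ 1) :
    |normSq (edgePoint (Real.pi / (4 * n)) k s) - normSq (edgePoint (Real.pi / (4 * n)) l t)| *
        Real.cos (Real.pi / (4 * n)) ≤
      2 * Real.sin (Real.pi / (4 * n)) *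
        |(conj (edgePoint (Real.pi / (4 * n)) k s) * edgePoint (Real.pi / (4 * n)) l t).im| := by
  have hn0 : (0 : ℝ) < n := by exact_mod_cast hn
  rw [normSq_edgePoint, normSq_edgePoint, conj_mul_edgePoint_im]
  refine edge_inequality (cos_angle_pos hn).le (sin_angle_pos hn).le
    (by rw [add_comm]; exact Real.sin_sq_add_cos_sq _) (sin_angle_sq_le hn)
    (by rw [add_comm]; exact Real.sin_sq_add_cos_sq _) ?_ hs ht
  -- Edge normals differ by multiples of 2α = π/(2n).
  have h := sin_eq_zero_or_abs_cos_le (m := 2 * n) (by omega) ((l : ℤ) - k)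
  have e : ∀ y : ℝ, y * (Real.pi / ((2 * n : ℕ) : ℝ)) = 2 * y * (Real.pi / (4 * n)) := by
    intro y; push_cast; field_simp; ring
  rw [e, ← one_mul (Real.pi / ((2 * n : ℕ) : ℝ)), e, mul_one] at h
  rwa [← Real.cos_two_mul']

/-! ### Norms whose unit circle is a linear image of the regular 4n-gon -/

section Model

variable {V : Type*} [NormedAddCommGroup V] [NormedSpace ℝ V]

/-- The unit circle of `V` is the image of the standard regular `4n`-gon under the linear
isomorphism `L`. -/
def IsRegularModel (n : ℕ) (L : ℂ ≃ₗ[ℝ] V) : Prop :=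
  ∀ v : V, ‖v‖ = 1 ↔ ∃ k < 4 * n, ∃ s : ℝ, |s| ≤ 1 ∧ v = L (edgePoint (Real.pi / (4 * n)) k s)

namespace IsRegularModel

variable {n : ℕ} {L : ℂ ≃ₗ[ℝ] V}

lemma exists_eq_norm_smul_edgePoint (h : IsRegularModel n L) (z : ℂ) :
    ∃ (k : ℕ) (s : ℝ), |s| ≤ 1 ∧ z = ‖L z‖ • edgePoint (Real.pi / (4 * n)) k s := by
  by_cases hz : z = 0
  · exact ⟨0, 0, by simp, by simp [hz]⟩
  have hL : ‖L z‖ ≠ 0 := by simpa using hz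
  obtain ⟨k, -, s, hs, e⟩ := (h (‖L z‖⁻¹ • L z)).1 (by rw [norm_smul]; simp [hL])
  refine ⟨k, s, hs, ?_⟩
  rw [← map_smul] at e
  rw [← L.injective e, smul_smul, mul_inv_cancel₀ hL, one_smul]

lemma norm_le (h : IsRegularModel n L) (z : ℂ) : ‖z‖ ≤ ‖L z‖ := by
  obtain ⟨k, s, hs, e⟩ := h.exists_eq_norm_smul_edgePoint z
  calc ‖z‖ = ‖L z‖ * ‖edgePoint (Real.pi / (4 * n)) k s‖ := by
        conv_lhs => rw [e, norm_smul, norm_norm]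
    _ ≤ ‖L z‖ := mul_le_of_le_one_right (norm_nonneg _) (norm_edgePoint_le _ _ hs)

lemma cos_mul_le_norm (h : IsRegularModel n L) (z : ℂ) :
    Real.cos (Real.pi / (4 * n)) * ‖L z‖ ≤ ‖z‖ := by
  obtain ⟨k, s, hs, e⟩ := h.exists_eq_norm_smul_edgePoint z
  have h1 : Real.cos (Real.pi / (4 * n)) ≤ ‖edgePoint (Real.pi / (4 * n)) k s‖ := by
    refine abs_le_of_sq_le_sq' ?_ (norm_nonneg _) |>.2
    rw [← normSq_eq_norm_sq, normSq_edgePoint]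
    nlinarith [mul_nonneg (sq_nonneg (Real.sin (Real.pi / (4 * n)))) (sq_nonneg s)]
  calc _ ≤ ‖edgePoint (Real.pi / (4 * n)) k s‖ * ‖L z‖ :=
        mul_le_mul_of_nonneg_right h1 (norm_nonneg _)
    _ = ‖z‖ := by
        conv_rhs => rw [e, norm_smul, norm_norm, mul_comm]

/-- Points of the bisector of `-x` and `x` are almost orthogonal to `x` in the Euclidean sense. -/
lemma cos_mul_norm_mul_norm_le (h : IsRegularModel n L) (hn : 1 ≤ n) {x z : ℂ}
    (hxz : ‖L (z + x)‖ = ‖L (z - x)‖) :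
    Real.cos (Real.pi / (4 * n)) * (‖x‖ * ‖z‖) ≤ |(conj x * z).im| := by
  obtain ⟨k, s, hs, hp⟩ := h.exists_eq_norm_smul_edgePoint (z + x)
  obtain ⟨l, t, ht, hq⟩ := h.exists_eq_norm_smul_edgePoint (z - x)
  have key := abs_normSq_sub_le hn k l hs ht
  rw [← hxz] at hq
  generalize ‖L (z + x)‖ = r at hp hq
  generalize edgePoint (Real.pi / (4 * n)) k s = p at *
  generalize edgePoint (Real.pi / (4 * n)) l t = q at *
  have hc := cos_angle_pos hn
  have h1 := Real.sin_sq_add_cos_sq (Real.pi / (4 * n))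
  generalize Real.cos (Real.pi / (4 * n)) = c at *
  generalize Real.sin (Real.pi / (4 * n)) = σ at *
  -- Polarization: |z + x|² - |z - x|² = 4 Re(x̄z), and below Im of conj(z + x)(z - x) is 2 Im(x̄z).
  have e1 : 4 * (conj x * z).re = r ^ 2 * (normSq p - normSq q) := by
    have a : normSq (z + x) = r ^ 2 * normSq p := by
      rw [hp, normSq_eq_norm_sq, norm_smul, normSq_eq_norm_sq, mul_pow, Real.norm_eq_abs, sq_abs]
    have b : normSq (z - x) = r ^ 2 * normSq q := by
      rw [hq, normSq_eq_norm_sq, norm_smul, normSq_eq_norm_sq, mul_pow, Real.norm_eq_abs, sq_abs]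
    rw [mul_sub, ← a, ← b]
    simp only [normSq_apply, mul_re, conj_re, conj_im, add_re, add_im, sub_re, sub_im]
    ring
  have e2 : 2 * (conj x * z).im = r ^ 2 * (conj p * q).im := by
    have a : (conj (z + x) * (z - x)).im = r ^ 2 * (conj p * q).im := by
      rw [hp, hq]
      simp only [real_smul, map_mul, conj_ofReal, mul_im, mul_re, ofReal_re, ofReal_im]
      ring
    rw [← a]
    simp only [mul_im, conj_re, conj_im, add_re, add_im, sub_re, sub_im]
    ring
  -- The angle between z and the normal of x has tangent at most tan α.
  have key2 : |(conj x * z).re| * c ≤ σ * |(conj x * z).im| := by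
    have a := mul_le_mul_of_nonneg_left key (sq_nonneg r)
    have b : |4 * (conj x * z).re| = r ^ 2 * |normSq p - normSq q| := by
      rw [e1, abs_mul, abs_of_nonneg (sq_nonneg r)]
    have b' : |2 * (conj x * z).im| = r ^ 2 * |(conj p * q).im| := by
      rw [e2, abs_mul, abs_of_nonneg (sq_nonneg r)]
    rw [abs_mul, abs_of_pos (by norm_num : (0 : ℝ) < 4)] at b
    rw [abs_mul, abs_of_pos (by norm_num : (0 : ℝ) < 2)] at b'
    have d : 4 * (|(conj x * z).re| * c) = r ^ 2 * (|normSq p - normSq q| * c) := by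
      linear_combination c * b
    have d' : 4 * (σ * |(conj x * z).im|) = r ^ 2 * (2 * σ * |(conj p * q).im|) := by
      linear_combination 2 * σ * b'
    linarith
  have key3 := pow_le_pow_left₀ (mul_nonneg (abs_nonneg _) hc.le) key2 2
  rw [mul_pow, mul_pow, sq_abs, sq_abs] at key3
  have e3 : (‖x‖ * ‖z‖) ^ 2 = (conj x * z).re ^ 2 + (conj x * z).im ^ 2 := by
    rw [← norm_conj x, ← norm_mul, ← normSq_eq_norm_sq, normSq_apply]
    ring
  refine abs_le_of_sq_le_sq' ?_ (abs_nonneg _) |>.2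
  rw [mul_pow, e3, sq_abs]
  nlinarith

lemma cos_sq_le_sine (h : IsRegularModel n L) (hn : 1 ≤ n) {x w : V} (hx : ‖x‖ = 1)
    (hw : w ∈ innerProj x) : Real.cos (Real.pi / (4 * n)) ^ 2 ≤ sine w x := by
  obtain ⟨z, ⟨⟨hz, -⟩, hz0⟩, rfl⟩ := hw
  obtain ⟨x, rfl⟩ := L.surjective x
  obtain ⟨z, rfl⟩ := L.surjective z
  have hz0' : ‖L z‖ ≠ 0 := by simpa using hz0
  have hc := cos_angle_pos hn
  have hx0 : 0 < ‖x‖ := hc.trans_le (by simpa [hx] using h.cos_mul_le_norm x)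
  have hxz : ‖L (z + x)‖ = ‖L (z - x)‖ := by
    rw [map_add, map_sub, ← sub_neg_eq_add]
    exact hz
  have h1 := h.cos_mul_norm_mul_norm_le hn hxz
  have h2 := h.cos_mul_le_norm z
  refine le_ciInf fun t => ?_
  have e : ‖L z‖⁻¹ • L z + t • L x = L (‖L z‖⁻¹ • z + t • x) := by
    rw [map_add, map_smul, map_smul]
  rw [e]
  refine le_trans ?_ (h.norm_le _)
  -- Im(x̄ ·) is unchanged by adding real multiples of x, so the bound is uniform in t.
  have h3 : ‖L z‖⁻¹ * |(conj x * z).im| ≤ ‖x‖ * ‖‖L z‖⁻¹ • z + t • x‖ := by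
    have e' : ‖L z‖⁻¹ * (conj x * z).im = (conj x * (‖L z‖⁻¹ • z + t • x)).im := by
      simp only [mul_im, conj_re, conj_im, add_re, add_im, smul_re, smul_im, smul_eq_mul]
      ring
    rw [← norm_conj x, ← norm_mul, ← abs_of_nonneg (inv_nonneg.2 (norm_nonneg (L z))),
      ← abs_mul, abs_of_nonneg (inv_nonneg.2 (norm_nonneg (L z))), e']
    exact abs_im_le_norm _
  have hpos : 0 < ‖L z‖ := lt_of_le_of_ne (norm_nonneg _) (Ne.symm hz0')
  have h4 : Real.cos (Real.pi / (4 * n)) ^ 2 * ‖x‖ ≤ ‖L z‖⁻¹ * |(conj x * z).im| := by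
    rw [inv_mul_eq_div, le_div_iff₀ hpos]
    nlinarith [mul_le_mul_of_nonneg_left h2 (mul_nonneg hc.le hx0.le)]
  exact le_of_mul_le_mul_left (by linarith) hx0

lemma norm_edge_zero (h : IsRegularModel n L) (hn : 1 ≤ n) {s : ℝ} (hs : |s| ≤ 1) :
    ‖L (edgePoint (Real.pi / (4 * n)) 0 s)‖ = 1 :=
  (h _).2 ⟨0, by omega, s, hs, rfl⟩

lemma norm_I (h : IsRegularModel n L) (hn : 1 ≤ n) : ‖L I‖ = 1 :=
  (h _).2 ⟨n, by omega, -1, by simp, by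
    rw [edgePoint_quarter_turn hn, edgePoint_zero_neg_one, mul_one]⟩

/-- The witnesses are x on edge 0 and w, the midpoint of edge n, which is parallel to edge 0 because
n edges make a quarter turn. For short μ, x + μw and x - μw stay on edge 0, so both have norm 1. -/
lemma exists_sine_le (h : IsRegularModel n L) (hn : 1 ≤ n) {s : ℝ} (hs : -1 < s) (hs0 : s < 0) :
    ∃ x : V, ‖x‖ = 1 ∧ ∃ w ∈ innerProj x, sine w x ≤
      Real.cos (Real.pi / (4 * n)) ^ 2 /
        (Real.cos (Real.pi / (4 * n)) ^ 2 - s * Real.sin (Real.pi / (4 * n)) ^ 2) := by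
  have hc := cos_angle_pos hn
  have hσ := sin_angle_pos hn
  have hw1 : ‖L (edgePoint (Real.pi / (4 * n)) n 0)‖ = 1 :=
    (h _).2 ⟨n, by omega, 0, by simp, rfl⟩
  have hedge : ∀ r : ℝ, |r| ≤ 1 → ‖L (edgePoint (Real.pi / (4 * n)) 0 r)‖ = 1 :=
    fun r hr => h.norm_edge_zero hn hr
  rw [edgePoint_quarter_turn hn] at hw1
  have hI := h.norm_I hn
  have hre := edgePoint_zero_re (Real.pi / (4 * n)) s
  have h1 := Real.sin_sq_add_cos_sq (Real.pi / (4 * n))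
  have him : (conj (edgePoint (Real.pi / (4 * n)) 0 s) *
      (I * edgePoint (Real.pi / (4 * n)) 0 0)).im = Real.cos (Real.pi / (4 * n)) ^ 2 := by
    rw [← edgePoint_quarter_turn hn, conj_mul_edgePoint_im]
    have : (2 * (((n : ℕ) : ℤ) - (0 : ℕ) : ℤ) * (Real.pi / (4 * n)) : ℝ) = Real.pi / 2 := by
      have hn0 : (n : ℝ) ≠ 0 := by positivity
      push_cast; field_simp; ring
    rw [this, Real.cos_pi_div_two, Real.sin_pi_div_two]
    ring
  -- Sliding by one unit of the edge parameter is a move of length sin α, while |w| = cos α.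
  have hshift : ∀ r τ : ℝ, edgePoint (Real.pi / (4 * n)) 0 r +
      (τ * Real.sin (Real.pi / (4 * n)) / Real.cos (Real.pi / (4 * n))) •
        (I * edgePoint (Real.pi / (4 * n)) 0 0) = edgePoint (Real.pi / (4 * n)) 0 (r + τ) := by
    intro r τ
    have e : (⟨Real.cos (Real.pi / (4 * n)), r * Real.sin (Real.pi / (4 * n))⟩ : ℂ) +
        ((τ * Real.sin (Real.pi / (4 * n)) / Real.cos (Real.pi / (4 * n)) : ℝ) : ℂ) *
          (I * ⟨Real.cos (Real.pi / (4 * n)), 0 * Real.sin (Real.pi / (4 * n))⟩) =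
        ⟨Real.cos (Real.pi / (4 * n)), (r + τ) * Real.sin (Real.pi / (4 * n))⟩ := by
      apply Complex.ext
      · rw [add_re, re_ofReal_mul]; simp
      · rw [add_im, im_ofReal_mul]; simp; field_simp
    rw [edgePoint, edgePoint, edgePoint, ← e, real_smul]
    ring
  set x := edgePoint (Real.pi / (4 * n)) 0 s with hx
  set w := I * edgePoint (Real.pi / (4 * n)) 0 0 with hw
  set c := Real.cos (Real.pi / (4 * n))
  set σ := Real.sin (Real.pi / (4 * n))
  refine ⟨L x, hedge s (abs_le.2 ⟨hs.le, by linarith⟩), L w, ?_, ?_⟩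
  · obtain ⟨τ, hτ0, hτ1, hτ2⟩ : ∃ τ : ℝ, 0 < τ ∧ |s + τ| ≤ 1 ∧ |s + -τ| ≤ 1 ∧
        τ * σ / c ≤ 1 := by
      -- The bound 1 + s keeps s - τ on the edge (s + τ is then safe as s < 0); c/σ keeps the
      -- multiple of w in the unit ball.
      refine ⟨min (1 + s) (c / σ), lt_min (by linarith) (by positivity), ?_, ?_, ?_⟩
      · have := min_le_left (1 + s) (c / σ)
        have : 0 < min (1 + s) (c / σ) := lt_min (by linarith) (by positivity)
        rw [abs_le]; constructor <;> linarith
      · have := min_le_left (1 + s) (c / σ)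
        have : 0 < min (1 + s) (c / σ) := lt_min (by linarith) (by positivity)
        rw [abs_le]; constructor <;> linarith
      · rw [div_le_one hc, ← le_div_iff₀ hσ]
        exact min_le_right _ _
    have hμ : 0 < τ * σ / c := by positivity
    have hnorm : ‖(τ * σ / c) • L w‖ = τ * σ / c := by
      rw [norm_smul, hw1, mul_one, Real.norm_of_nonneg hμ.le]
    refine ⟨(τ * σ / c) • L w, ⟨⟨?_, ?_⟩, ?_⟩, ?_⟩
    · change ‖(τ * σ / c) • L w - -L x‖ = ‖(τ * σ / c) • L w - L x‖
      have a1 : (τ * σ / c) • L w - -L x = L (edgePoint (Real.pi / (4 * n)) 0 (s + τ)) := by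
        rw [← hshift, map_add, map_smul, sub_neg_eq_add, add_comm]
      have a2 : (τ * σ / c) • L w - L x = -L (edgePoint (Real.pi / (4 * n)) 0 (s + -τ)) := by
        rw [← hshift, neg_mul, neg_div, map_add, map_smul, neg_smul, neg_add, neg_neg, add_comm,
          sub_eq_add_neg]
      rw [a1, a2, norm_neg, hedge _ hτ1, hedge _ hτ2.1]
    · rw [mem_closedBall_zero_iff, hnorm]
      exact hτ2.2
    · exact norm_ne_zero_iff.1 (hnorm.trans_ne hμ.ne')
    · change ‖(τ * σ / c) • L w‖⁻¹ • (τ * σ / c) • L w = L w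
      rw [hnorm, smul_smul, inv_mul_cancel₀ hμ.ne', one_smul]
  · have hxre : 0 < x.re := by rw [hre]; nlinarith [pow_pos hc 2, pow_pos hσ 2]
    rw [← hre]
    -- This t cancels the real part, leaving a multiple of the vertex i, which has norm 1.
    refine (ciInf_le ⟨0, ?_⟩ (-(w.re / x.re))).trans_eq ?_
    · rintro _ ⟨t, rfl⟩
      exact norm_nonneg _
    have e : w + (-(w.re / x.re)) • x = (c ^ 2 / x.re) • I := by
      apply Complex.ext
      · rw [add_re, smul_re, smul_re]; simp; field_simp; ring
      · rw [← him, add_im, smul_im, smul_im]; simp; field_simp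
    rw [← map_smul, ← map_add, e, map_smul, norm_smul, hI, mul_one,
      Real.norm_of_nonneg (by positivity)]

end IsRegularModel

/-- In a normed space of dimension at least two, inner projections are non-empty. -/
lemma innerProj_nonempty (hV : 1 < Module.rank ℝ V) {x : V} (hx : ‖x‖ = 1) :
    (innerProj x).Nonempty := by
  have hcont : ContinuousOn (fun y : V => ‖y - x‖ - ‖y + x‖) (Metric.sphere 0 1) := by fun_prop
  have hxS : x ∈ Metric.sphere (0 : V) 1 := by simpa using hx
  have hxS' : -x ∈ Metric.sphere (0 : V) 1 := by simpa using hx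
  have h2 : ‖x + x‖ = 2 := by
    rw [← two_smul ℝ x, norm_smul, hx]; norm_num
  obtain ⟨y, hy, hy0⟩ := (isPreconnected_sphere hV (0 : V) 1).intermediate_value hxS hxS' hcont
    (show (0 : ℝ) ∈ Set.Icc _ _ by
      constructor
      · simp [h2]
      · have : ‖-x - x‖ = 2 := by rw [← h2, ← norm_neg]; congr 1; abel
        simp [this])
  have hy1 : ‖y‖ = 1 := by simpa using hy
  refine ⟨y, y, ⟨⟨?_, ?_⟩, ?_⟩, ?_⟩
  · change ‖y - -x‖ = ‖y - x‖
    rw [sub_neg_eq_add]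
    simp only at hy0
    linarith
  · simp [hy1]
  · rintro rfl
    simp at hy1
  · simp [hy1]

lemma sine_nonneg (w x : V) : 0 ≤ sine w x := Real.iInf_nonneg fun _ => norm_nonneg _

lemma cB_le_sine {x w : V} (hx : ‖x‖ = 1) (hw : w ∈ innerProj x) : cB V ≤ sine w x := by
  have h1 : cB V ≤ ⨅ w : innerProj x, sine (w : V) x :=
    ciInf_le (f := fun x : Metric.sphere (0 : V) 1 => ⨅ w : innerProj (x : V), sine (w : V) (x : V))
      ⟨0, by rintro _ ⟨y, rfl⟩; exact Real.iInf_nonneg fun _ => sine_nonneg _ _⟩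
      ⟨x, by simpa using hx⟩
  exact h1.trans (ciInf_le (f := fun w : innerProj x => sine (w : V) x)
    ⟨0, by rintro _ ⟨y, rfl⟩; exact sine_nonneg _ _⟩ ⟨w, hw⟩)

theorem IsRegularModel.cB_eq {n : ℕ} {L : ℂ ≃ₗ[ℝ] V} (h : IsRegularModel n L) (hn : 1 ≤ n)
    (hV : 1 < Module.rank ℝ V) : cB V = Real.cos (Real.pi / (4 * n)) ^ 2 := by
  apply le_antisymm
  · set c := Real.cos (Real.pi / (4 * n)) with hc
    set σ := Real.sin (Real.pi / (4 * n)) with hσ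
    have h1 : σ ^ 2 + c ^ 2 = 1 := Real.sin_sq_add_cos_sq _
    have hcont : Filter.Tendsto (fun s : ℝ => c ^ 2 / (c ^ 2 - s * σ ^ 2))
        (nhdsWithin (-1) (Set.Ioi (-1))) (nhds (c ^ 2)) := by
      have hcont : ContinuousAt (fun s : ℝ => c ^ 2 / (c ^ 2 - s * σ ^ 2)) (-1) := by
        refine ContinuousAt.div (by fun_prop) (by fun_prop) ?_
        nlinarith
      have h' := hcont.tendsto.mono_left (nhdsWithin_le_nhds (s := Set.Ioi (-1)))
      have e : c ^ 2 / (c ^ 2 - -1 * σ ^ 2) = c ^ 2 := by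
        rw [show c ^ 2 - -1 * σ ^ 2 = 1 by linarith, div_one]
      rwa [e] at h'
    -- The witnesses need x strictly inside the edge, so the value at the vertex s = -1 is reached
    -- only as a limit.
    refine ge_of_tendsto hcont ?_
    filter_upwards [Ioo_mem_nhdsGT (show (-1 : ℝ) < 0 by norm_num)] with s hs
    obtain ⟨x, hx, w, hw, hle⟩ := h.exists_sine_le hn hs.1 hs.2
    exact (cB_le_sine hx hw).trans hle
  · have : Nonempty (Metric.sphere (0 : V) 1) := ⟨L I, by simpa using h.norm_I hn⟩
    refine le_ciInf fun x => ?_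
    have hx : ‖(x : V)‖ = 1 := by simp
    -- A real infimum over an empty family would be 0, so non-emptiness matters here.
    have : Nonempty (innerProj (x : V)) := (innerProj_nonempty hV hx).to_subtype
    exact le_ciInf fun w => h.cos_sq_le_sine hn hx w.2

end Model

/-! ### From affine regular polygons to the linear model -/

lemma lineMap_exp_eq_edgePoint {n : ℕ} (hn : 1 ≤ n) (k : ℕ) (μ : ℝ) :
    AffineMap.lineMap (exp (2 * Real.pi * I * (k : ℂ) / ((4 * n : ℕ) : ℂ)))
      (exp (2 * Real.pi * I * ((k + 1 : ℕ) : ℂ) / ((4 * n : ℕ) : ℂ))) μ =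
      edgePoint (Real.pi / (4 * n)) k (2 * μ - 1) := by
  have hn0 : (n : ℂ) ≠ 0 := by exact_mod_cast (by omega : n ≠ 0)
  set α := Real.pi / (4 * n) with hα
  have e1 : 2 * Real.pi * I * (k : ℂ) / ((4 * n : ℕ) : ℂ) =
      (((2 * k + 1) * α : ℝ) : ℂ) * I + ((-α : ℝ) : ℂ) * I := by
    rw [hα]; push_cast; field_simp; ring
  have e2 : 2 * Real.pi * I * ((k + 1 : ℕ) : ℂ) / ((4 * n : ℕ) : ℂ) =
      (((2 * k + 1) * α : ℝ) : ℂ) * I + ((α : ℝ) : ℂ) * I := by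
    rw [hα]; push_cast; field_simp; ring
  have e3 : (⟨Real.cos α, (2 * μ - 1) * Real.sin α⟩ : ℂ) =
      (μ : ℂ) * (exp ((α : ℝ) * I) - exp (((-α : ℝ) : ℂ) * I)) + exp (((-α : ℝ) : ℂ) * I) := by
    rw [exp_mul_I, exp_mul_I, ← ofReal_cos, ← ofReal_sin, ← ofReal_cos, ← ofReal_sin,
      Real.cos_neg, Real.sin_neg]
    apply Complex.ext
    · simp [-ofReal_cos, -ofReal_sin]
    · simp [-ofReal_cos, -ofReal_sin]; ring
  rw [AffineMap.lineMap_apply, e1, e2, exp_add, exp_add, edgePoint, e3, vsub_eq_sub, vadd_eq_add,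
    real_smul]
  ring

lemma mem_boundary_iff {V : Type*} [AddCommGroup V] [Module ℝ V] {n : ℕ} (hn : 1 ≤ n)
    {P : Polygon V (4 * n)} {T : ℂ ≃ᵃ[ℝ] V}
    (hT : ∀ k : Fin (4 * n),
      P k = T (exp (2 * Real.pi * I * ((k : ℕ) : ℂ) / ((4 * n : ℕ) : ℂ)))) (v : V) :
    v ∈ P.boundary ℝ ↔
      ∃ k < 4 * n, ∃ s : ℝ, |s| ≤ 1 ∧ v = T (edgePoint (Real.pi / (4 * n)) k s) := by
  have hn0 : (n : ℂ) ≠ 0 := by exact_mod_cast (by omega : n ≠ 0)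
  have hrot : ∀ k : Fin (4 * n), P (finRotate _ k) =
      T (exp (2 * Real.pi * I * (((k : ℕ) + 1 : ℕ) : ℂ) / ((4 * n : ℕ) : ℂ))) := by
    obtain ⟨m, hm⟩ : ∃ m, 4 * n = m + 1 := ⟨4 * n - 1, by omega⟩
    intro k
    rw [hT]
    congr 1
    by_cases hk : (k : ℕ) + 1 < 4 * n
    · have : ((finRotate _ k : Fin (4 * n)) : ℕ) = k + 1 := by
        clear hT
        revert k
        rw [hm]
        intro k hk
        exact coe_finRotate_of_ne_last (by rintro rfl; simp at hk)
      rw [this]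
    -- The last edge closes up at vertex 0, matching exp(2πi) = 1.
    · have : ((finRotate _ k : Fin (4 * n)) : ℕ) = 0 := by
        clear hT
        revert k
        rw [hm]
        intro k hk
        have : k = Fin.last m := Fin.ext (by simp; omega)
        rw [this, finRotate_last]; rfl
      have hk' : (k : ℕ) + 1 = 4 * n := by omega
      rw [this, hk', Nat.cast_zero, mul_zero, zero_div, exp_zero, mul_div_assoc, div_self, mul_one,
        exp_two_pi_mul_I]
      simp; omega
  rw [Polygon.boundary, Set.mem_iUnion]
  constructor
  · rintro ⟨k, μ, hμ, rfl⟩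
    refine ⟨k, k.2, 2 * μ - 1, abs_le.2 ⟨by linarith [hμ.1], by linarith [hμ.2]⟩, ?_⟩
    rw [hrot, hT, ← AffineEquiv.apply_lineMap, lineMap_exp_eq_edgePoint hn]
  · rintro ⟨k, hk, s, hs, rfl⟩
    rw [abs_le] at hs
    refine ⟨⟨k, hk⟩, (s + 1) / 2, ⟨by linarith [hs.1], by linarith [hs.2]⟩, ?_⟩
    rw [hrot, hT, ← AffineEquiv.apply_lineMap, lineMap_exp_eq_edgePoint hn]
    congr 2
    ring

/-- The center of an affine regular polygon that is a unit circle is the origin. -/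
lemma isRegularModel_linear {V : Type*} [NormedAddCommGroup V] [NormedSpace ℝ V] {n : ℕ}
    (hn : 1 ≤ n) {T : ℂ ≃ᵃ[ℝ] V}
    (hS : ∀ v : V, ‖v‖ = 1 ↔
      ∃ k < 4 * n, ∃ s : ℝ, |s| ≤ 1 ∧ v = T (edgePoint (Real.pi / (4 * n)) k s)) :
    IsRegularModel n T.linear := by
  have hlin : ∀ z : ℂ, T z = T.linear z + T 0 := by
    intro z
    have := T.map_vadd 0 z
    simpa using this
  obtain ⟨d, hd⟩ := T.linear.surjective (T 0)
  -- With T = L(· + d), symmetry of the unit circle makes p + 2d the negative of a polygon point,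
  -- hence in the unit disc. Taking p = 1 and p = -1 forces d = 0.
  have hbound : ∀ k < 4 * n, ∀ s : ℝ, |s| ≤ 1 →
      ‖edgePoint (Real.pi / (4 * n)) k s + (d + d)‖ ≤ 1 := by
    intro k hk s hs
    have h1 : ‖-T (edgePoint (Real.pi / (4 * n)) k s)‖ = 1 := by
      rw [norm_neg]; exact (hS _).2 ⟨k, hk, s, hs, rfl⟩
    obtain ⟨l, -, t, ht, e⟩ := (hS _).1 h1
    rw [hlin, hlin (edgePoint _ l t), ← hd, ← map_add, ← map_add, ← map_neg] at e
    have e' := T.linear.injective e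
    have : edgePoint (Real.pi / (4 * n)) k s + (d + d) = -edgePoint (Real.pi / (4 * n)) l t := by
      rw [eq_neg_iff_add_eq_zero]
      linear_combination -e'
    rw [this, norm_neg]
    exact norm_edgePoint_le _ _ ht
  have b1 := hbound 0 (by omega) (-1) (by simp)
  have b2 := hbound (2 * n) (by omega) (-1) (by simp)
  rw [edgePoint_half_turn hn] at b2
  rw [edgePoint_zero_neg_one] at b1 b2
  rw [← sq_le_one_iff₀ (norm_nonneg _), ← normSq_eq_norm_sq, normSq_apply] at b1 b2
  simp at b1 b2
  have hd0 : d = 0 := by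
    apply Complex.ext
    · simp; nlinarith [sq_nonneg d.re, sq_nonneg d.im]
    · simp; nlinarith [sq_nonneg d.re, sq_nonneg d.im]
  have hT0 : T 0 = 0 := by rw [← hd, hd0, map_zero]
  intro v
  have hT' : ∀ z : ℂ, T z = T.linear z := fun z => by rw [hlin, hT0, add_zero]
  simp_rw [hS, hT']

end NormedPlane

theorem proposition4p3 (n : ℕ) (hn : 1 ≤ n)
    {V : Type*} [NormedAddCommGroup V] [NormedSpace ℝ V] (hV : Module.finrank ℝ V = 2)
    (P : Polygon V (4 * n)) (hP : NormedPlane.IsAffineRegular P)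
    (hS : Metric.sphere (0 : V) 1 = P.boundary ℝ) :
    NormedPlane.cB V = Real.cos (Real.pi / (4 * n)) ^ 2 := by
  obtain ⟨T, hT⟩ := hP
  have hmodel : NormedPlane.IsRegularModel n T.linear :=
    NormedPlane.isRegularModel_linear hn fun v => by
      rw [← NormedPlane.mem_boundary_iff hn hT, ← hS, mem_sphere_zero_iff_norm]
  exact hmodel.cB_eq hn (Module.one_lt_rank_of_one_lt_finrank (by omega))
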